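/- Let $V$ be an infinite set and let $\phi:V\to\mathbb R^2$ be such that the open disks ("pennies") $B_v$ of radius $\tfrac12$ centered at $\phi(v)$, $v\in V$, are pairwise disjoint. Let $(V,E)$ be the contact graph, in which $v\neq w$ are adjacent if and only if the bounding circles of $B_v$ and $B_w$ are tangent (equivalently $|\phi(v)\phi(w)|=1$). Assume that $(V,E)$ is connected and let $d$ be its combinatorial distance. Let $S\subset\mathbb R^2$ be the union of all centers $\phi(v)$ and of all segments $\overline{\phi(v)\phi(w)}$ with $\{v,w\}\in E$. The faces are the connected components of $\mathbb R^2\setminus S$, and the degree $\deg(\sigma)\in\mathbb N\cup\{\infty\}$ of a face $\sigma$ is its number of corners (interior angles), i.e. the number of pairs $(v,A)$ where $v\in V$ and $A$ is a connected component of $B_v\setminus S$ with $A\subset\sigma$. Let $D\ge 0$ be a real number such that $\deg(\sigma)\le D$ for every face $\sigma$. Then for all $x,y\in V$ $$\frac1{2D}\,d(x,y)\le|\phi(x)\phi(y)|\le d(x,y).$$ Moreover, for every $z\in\mathbb R^2$ there is $x\in V$ with $|z\,\phi(x)|\le D/2$. Finally, $\phi$ is a quasi-isometry from $(V,d)$ to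 $(\mathbb R^2,|\cdot|)$: there are $a\ge1$ and $C>0$ such that $a^{-1}d(x,y)-C\le|\phi(x)\phi(y)|\le a\,d(x,y)+C$ for all $x,y\in V$, and every $z\in\mathbb R^2$ satisfies $|z\,\phi(x)|<C$ for some $x\in V$. -/

import Mathlib

open scoped ENNReal NNReal

/-- The Euclidean plane. -/
abbrev Plane : Type := EuclideanSpace ℝ (Fin 2)

/-- A configuration of non-overlapping pennies (open disks of radius `1/2`) in the plane,
indexed by `V` and recorded by their centers. -/
structure PennyConfiguration (V : Type*) where
  /-- the center of each penny -/
  center : V → Plane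
  /-- distinct pennies are disjoint -/
  disjoint_pennies : ∀ v w : V, v ≠ w →
    Disjoint (Metric.ball (center v) (1 / 2)) (Metric.ball (center w) (1 / 2))

namespace PennyConfiguration

variable {V : Type*}

/-- The penny (open disk) at `v`. -/
def penny (P : PennyConfiguration V) (v : V) : Set Plane :=
  Metric.ball (P.center v) (1 / 2)

/-- The circle bounding the penny at `v`. -/
noncomputable def circle (P : PennyConfiguration V) (v : V) : EuclideanGeometry.Sphere Plane :=
  ⟨P.center v, 1 / 2⟩

/-- Two circles of the configuration are externally tangent iff their centers are at distance
one. -/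
theorem isExtTangent_circle_iff (P : PennyConfiguration V) (v w : V) :
    (P.circle v).IsExtTangent (P.circle w) ↔ dist (P.center v) (P.center w) = 1 := by
  rw [EuclideanGeometry.Sphere.isExtTangent_iff_dist_center]
  norm_num [circle]

/-- The contact graph: two vertices are joined by an edge iff their circles are tangent. -/
def graph (P : PennyConfiguration V) : SimpleGraph V where
  Adj v w := (P.circle v).IsExtTangent (P.circle w)
  symm := ⟨fun v w h => by
    rw [isExtTangent_circle_iff] at h ⊢
    rwa [dist_comm]⟩
  loopless := ⟨fun v h => by
    rw [isExtTangent_circle_iff] at h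
    simp at h⟩

/-- The image in the plane of the vertices and edges of the contact graph: all centers, and all
segments joining the centers of adjacent vertices. -/
def skeleton (P : PennyConfiguration V) : Set Plane :=
  Set.range P.center ∪
    {p | ∃ v w : V, P.graph.Adj v w ∧ p ∈ segment ℝ (P.center v) (P.center w)}

/-- `S` is a connected component of the subset `A` of the plane. -/
def IsComponentOf (S A : Set Plane) : Prop :=
  ∃ p ∈ A, S = connectedComponentIn A p

/-- The faces: the connected components of the complement of the embedded graph. -/
def IsFace (P : PennyConfiguration V) (σ : Set Plane) : Prop :=
  IsComponentOf σ P.skeletonᶜ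

/-- The corners (interior angles) of `σ`. The embedded edges at `v` cut the penny at `v` into open
circular sectors, one for each pair of consecutive edges at `v`; a corner of `σ` at `v` is such a
sector contained in `σ`. A sector of angle `π` counts as a corner, and a vertex at which `σ` has
several sectors contributes each of them. (No edge which is not incident to `v` meets the penny at
`v`, as all distances of centers are at least one.) -/
def corners (P : PennyConfiguration V) (σ : Set Plane) : Set (V × Set Plane) :=
  {c | IsComponentOf c.2 (P.penny c.1 \ P.skeleton) ∧ c.2 ⊆ σ}

/-- The facial degree, in `ℕ ∪ {∞}`: the number of corners. -/
noncomputable def facialDegree (P : PennyConfiguration V) (σ : Set Plane) : ℕ∞ :=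
  (P.corners σ).encard

/-- The combinatorial distance on the vertices of the contact graph. -/
noncomputable def combDist (P : PennyConfiguration V) (x y : V) : ℝ :=
  (P.graph.dist x y : ℝ)

end PennyConfiguration

/-- `ψ` is a quasi-isometry map from `(X, dX)` to `(Y, dY)`. -/
def IsQuasiIsometryMap {X Y : Type*} (dX : X → X → ℝ) (dY : Y → Y → ℝ) (ψ : X → Y) : Prop :=
  ∃ a C : ℝ, 1 ≤ a ∧ 0 < C ∧
    (∀ x₁ x₂ : X, a⁻¹ * dX x₁ x₂ - C ≤ dY (ψ x₁) (ψ x₂) ∧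
      dY (ψ x₁) (ψ x₂) ≤ a * dX x₁ x₂ + C) ∧
    ∀ y : Y, ∃ x : X, dY y (ψ x) < C

open Set Topology

/-! The upper bound holds since edges have length one. Everything else rests on one fact: two
vertices on the boundary of one face are at combinatorial distance at most `D - 1`. Since the
skeleton is connected, the complement of a face is connected, and so is the closure of the face; by
unicoherence of the plane their intersection, the frontier, is connected. Open stars of the boundary
vertices cover it, and two stars share a skeleton point only if their vertices are equal or
adjacent. So the boundary vertices induce a connected subgraph, in which a path has fewer edges than
the face has corners (`dist_lt_ncard_boundaryVertices`).

For the lower bound, walk straight towards `y`. From a point `p` of the skeleton continue to a point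
`q` where the segment leaves the union of the open stars of the vertices of the cell (vertex or open
edge) of `p`. The cells of `p` and `q` have no common vertex, so `1 / 2 ≤ dist p q`, yet a vertex of
one and a vertex of the other have intersecting stars. Each half unit of length thus costs at most
`D`: `D - 1` between these vertices, and one for changing the vertex within a cell
(`exists_next_cell`, `dist_le_of_onOpenEdge`).

For density, faces are bounded, and a segment from a boundary vertex through `z` to the frontier is
short enough that a vertex near one of its ends is within `D / 2` of `z`. -/

/-! ### Unicoherence and connectedness. -/

/-- Simply connected spaces are unicoherent. -/
theorem isPreconnected_inter_of_union_eq_univ {X : Type*} [TopologicalSpace X]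
    [SimplyConnectedSpace X] [LocallyPathConnectedSpace X] [NormalSpace X] {A B : Set X}
    (hA : IsClosed A) (hB : IsClosed B) (hA' : IsPreconnected A) (hB' : IsPreconnected B)
    (hAB : A ∪ B = univ) : IsPreconnected (A ∩ B) := by
  classical
  rw [isPreconnected_closed_iff]
  rintro t t' ht ht' hsub ⟨x, hx, hxt⟩ ⟨y, hy, hyt⟩
  by_contra hne
  have hdis : Disjoint (A ∩ B ∩ t) (A ∩ B ∩ t') := by
    rw [Set.disjoint_left]
    rintro z ⟨hz, h1⟩ ⟨-, h2⟩
    exact hne ⟨z, hz, h1, h2⟩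
  obtain ⟨h, h0, h1, -⟩ := exists_continuous_zero_one_of_isClosed
    ((hA.inter hB).inter ht) ((hA.inter hB).inter ht') hdis
  -- The two formulas agree on `A ∩ B`, where `h` is 0 or 1, because `π` and `-π` have the same
  -- exponential.
  let f : X → Circle := fun z => if z ∈ A then Circle.exp (Real.pi * h z)
    else Circle.exp (-(Real.pi * h z))
  have hfA : ∀ z ∈ A, f z = Circle.exp (Real.pi * h z) := fun z hz => if_pos hz
  have hfB : ∀ z ∈ B, f z = Circle.exp (-(Real.pi * h z)) := by
    intro z hz
    by_cases hzA : z ∈ A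
    · rw [hfA z hzA]
      rcases hsub ⟨hzA, hz⟩ with hzt | hzt
      · have : h z = 0 := h0 ⟨⟨hzA, hz⟩, hzt⟩
        simp [this]
      · have : h z = 1 := h1 ⟨⟨hzA, hz⟩, hzt⟩
        rw [this, Circle.exp_eq_exp]
        exact ⟨1, by push_cast; ring⟩
    · exact if_neg hzA
  have hf : Continuous f := by
    rw [← continuousOn_univ, ← hAB]
    refine ContinuousOn.union_of_isClosed ?_ ?_ hA hB
    · exact (Continuous.continuousOn (by fun_prop)).congr hfA
    · exact (Continuous.continuousOn (by fun_prop)).congr hfB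
  obtain ⟨g, ⟨-, hg⟩, -⟩ := Circle.isCoveringMap_exp.existsUnique_continuousMap_lifts ⟨f, hf⟩ x
    (Real.pi * h x) (hfA x hx.1).symm
  have hg' : ∀ z, Circle.exp (g z) = f z := fun z => congrFun hg z
  -- On `A` the lift `g` differs from `π h` by a constant, on `B` from `-π h`. Hence `g y - g x`
  -- would be both `π` and `-π`.
  have e1 : g x - Real.pi * h x = g y - Real.pi * h y := by
    refine Circle.isCoveringMap_exp.constOn_of_comp (g := fun z => g z - Real.pi * h z) hA'
      (Continuous.continuousOn (by fun_prop)) ?_ hx.1 hy.1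
    have key : ∀ z ∈ A, Circle.exp (g z - Real.pi * h z) = 1 := by
      intro z hz
      rw [Circle.exp_sub, hg', hfA z hz, div_self']
    intro a ha b hb
    rw [key a ha, key b hb]
  have e2 : g x + Real.pi * h x = g y + Real.pi * h y := by
    refine Circle.isCoveringMap_exp.constOn_of_comp (g := fun z => g z + Real.pi * h z) hB'
      (Continuous.continuousOn (by fun_prop)) ?_ hx.2 hy.2
    have key : ∀ z ∈ B, Circle.exp (g z + Real.pi * h z) = 1 := by
      intro z hz
      rw [Circle.exp_add, hg', hfB z hz, ← Circle.exp_add, neg_add_cancel, Circle.exp_zero]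
    intro a ha b hb
    rw [key a ha, key b hb]
  have hx0 : h x = 0 := h0 ⟨hx, hxt⟩
  have hy1 : h y = 1 := h1 ⟨hy, hyt⟩
  rw [hx0, hy1] at e1 e2
  linarith [Real.pi_pos]

/-- The complement of a closed ball in the plane is preconnected. -/
theorem isPreconnected_compl_closedBall_zero {E : Type*} [NormedAddCommGroup E]
    [NormedSpace ℝ E] (hE : 1 < Module.rank ℝ E) {R : ℝ} (hR : 0 ≤ R) :
    IsPreconnected (Metric.closedBall (0 : E) R)ᶜ := by
  have h1 : IsPreconnected (Ioi R ×ˢ Metric.sphere (0 : E) 1) :=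
    isPreconnected_Ioi.prod (isConnected_sphere hE 0 zero_le_one).isPreconnected
  have h2 := h1.image (fun p : ℝ × E => p.1 • p.2) (Continuous.continuousOn (by fun_prop))
  convert h2 using 1
  ext z
  simp only [mem_compl_iff, Metric.mem_closedBall, dist_zero_right, not_le, mem_image, mem_prod,
    mem_Ioi, mem_sphere_iff_norm, sub_zero, Prod.exists]
  constructor
  · intro hz
    have hz0 : ‖z‖ ≠ 0 := by linarith
    refine ⟨‖z‖, ‖z‖⁻¹ • z, ⟨hz, ?_⟩, ?_⟩
    · rw [norm_smul, norm_inv, norm_norm, inv_mul_cancel₀ hz0]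
    · rw [smul_smul, mul_inv_cancel₀ hz0, one_smul]
  · rintro ⟨a, b, ⟨ha, hb⟩, rfl⟩
    rw [norm_smul, hb, mul_one, Real.norm_eq_abs]
    exact ha.trans_le (le_abs_self a)

/-- A preconnected set meeting `s` but not its frontier lies in `s`. -/
theorem IsPreconnected.subset_of_disjoint_frontier {X : Type*} [TopologicalSpace X] {s t : Set X}
    (ht : IsPreconnected t) (h : (t ∩ s).Nonempty) (hd : Disjoint t (frontier s)) : t ⊆ s := by
  by_contra hcon
  obtain ⟨x, hx, hxs⟩ := not_subset.1 hcon
  obtain ⟨y, hy, hys⟩ := h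
  have h1 : t ⊆ interior s ∪ (closure s)ᶜ := by
    intro z hz
    by_contra hz'
    simp only [mem_union, mem_compl_iff, not_or, not_not] at hz'
    exact disjoint_left.1 hd hz ⟨hz'.2, hz'.1⟩
  obtain ⟨z, hz, hz1, hz2⟩ := ht _ _ isOpen_interior isClosed_closure.isOpen_compl h1
    ⟨y, hy, (h1 hy).resolve_right fun hh => hh (subset_closure hys)⟩
    ⟨x, hx, (h1 hx).resolve_left fun hh => hxs (interior_subset hh)⟩
  exact hz2 (subset_closure (interior_subset hz1))

/-! ### Separation of vertices and edges. -/

/-- The squared distance between convex combinations of two pairs of points. -/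
theorem dist_lineMap_lineMap_sq {E : Type*} [NormedAddCommGroup E] [InnerProductSpace ℝ E]
    (u v w x : E) (s t : ℝ) :
    dist (AffineMap.lineMap u v s) (AffineMap.lineMap w x t) ^ 2 =
      (1 - s) * (1 - t) * dist u w ^ 2 + (1 - s) * t * dist u x ^ 2 +
        s * (1 - t) * dist v w ^ 2 + s * t * dist v x ^ 2 -
        s * (1 - s) * dist u v ^ 2 - t * (1 - t) * dist w x ^ 2 := by
  simp only [AffineMap.lineMap_apply_module, dist_eq_norm, ← real_inner_self_eq_norm_sq,
    inner_sub_left, inner_sub_right, inner_add_left, inner_add_right, inner_smul_left,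
    inner_smul_right, real_inner_comm u, real_inner_comm v w, real_inner_comm v x,
    real_inner_comm w x, RCLike.conj_to_real]
  ring

namespace PennyConfiguration

variable {V : Type*} (P : PennyConfiguration V)

theorem adj_iff {v w : V} : P.graph.Adj v w ↔ dist (P.center v) (P.center w) = 1 :=
  P.isExtTangent_circle_iff v w

theorem one_le_dist {v w : V} (h : v ≠ w) : 1 ≤ dist (P.center v) (P.center w) := by
  have := (disjoint_ball_ball_iff (by norm_num) (by norm_num)).1 (P.disjoint_pennies v w h)
  linarith

theorem center_injective : Function.Injective P.center := by
  intro v w h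
  by_contra hne
  have := P.one_le_dist hne
  rw [h, dist_self] at this
  linarith

theorem finite_setOf_dist_le (z : Plane) (R : ℝ) : {v : V | dist (P.center v) z ≤ R}.Finite := by
  let _ : TopologicalSpace V := ⊥
  have : DiscreteTopology V := ⟨rfl⟩
  have he := Metric.isClosedEmbedding_of_pairwise_le_dist (zero_lt_one' ℝ) (f := P.center)
    fun v w h => P.one_le_dist h
  exact (he.isCompact_preimage (isCompact_closedBall z R)).finite_of_discrete

/-- Points on segments joining distinct pairs of close vertices are far apart. -/
theorem half_le_dist_sq_of_mem_segment {u v w x : V} {p q : Plane} (huw : u ≠ w) (hux : u ≠ x)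
    (hvw : v ≠ w) (hvx : v ≠ x) (huv : dist (P.center u) (P.center v) ≤ 1)
    (hwx : dist (P.center w) (P.center x) ≤ 1) (hp : p ∈ segment ℝ (P.center u) (P.center v))
    (hq : q ∈ segment ℝ (P.center w) (P.center x)) : 1 / 2 ≤ dist p q ^ 2 := by
  rw [segment_eq_image_lineMap] at hp hq
  obtain ⟨s, ⟨hs0, hs1⟩, rfl⟩ := hp
  obtain ⟨t, ⟨ht0, ht1⟩, rfl⟩ := hq
  -- The coefficients of the four cross distances sum to 1, so the square is at least `1 - s (1 - s)
  -- - t (1 - t) ≥ 1 / 2`.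
  rw [dist_lineMap_lineMap_sq]
  have sq1 : ∀ {a b : V}, a ≠ b → 1 ≤ dist (P.center a) (P.center b) ^ 2 := fun h =>
    one_le_pow₀ (P.one_le_dist h)
  have sq2 : ∀ {a b : V}, dist (P.center a) (P.center b) ≤ 1 →
    dist (P.center a) (P.center b) ^ 2 ≤ 1 := fun h => pow_le_one₀ dist_nonneg h
  have hs1' : 0 ≤ 1 - s := by linarith
  have ht1' : 0 ≤ 1 - t := by linarith
  have h1 := mul_le_mul_of_nonneg_left (sq1 huw) (mul_nonneg hs1' ht1')
  have h2 := mul_le_mul_of_nonneg_left (sq1 hux) (mul_nonneg hs1' ht0)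
  have h3 := mul_le_mul_of_nonneg_left (sq1 hvw) (mul_nonneg hs0 ht1')
  have h4 := mul_le_mul_of_nonneg_left (sq1 hvx) (mul_nonneg hs0 ht0)
  have h5 := mul_le_mul_of_nonneg_left (sq2 huv) (mul_nonneg hs0 hs1')
  have h6 := mul_le_mul_of_nonneg_left (sq2 hwx) (mul_nonneg ht0 ht1')
  nlinarith [sq_nonneg (s - 1 / 2), sq_nonneg (t - 1 / 2)]

theorem segment_subset_skeleton {v w : V} (h : P.graph.Adj v w) :
    segment ℝ (P.center v) (P.center w) ⊆ P.skeleton :=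
  fun _ hp => Or.inr ⟨v, w, h, hp⟩

theorem center_mem_skeleton (v : V) : P.center v ∈ P.skeleton := Or.inl ⟨v, rfl⟩

/-- The point `z` is the center of `u` or lies in the relative interior of an edge at `u`. -/
def OnOpenEdge (u : V) (z : Plane) : Prop :=
  z = P.center u ∨ ∃ w, P.graph.Adj u w ∧ z ∈ openSegment ℝ (P.center u) (P.center w)

theorem OnOpenEdge.mem_skeleton {u : V} {z : Plane} (h : P.OnOpenEdge u z) : z ∈ P.skeleton := by
  rcases h with rfl | ⟨w, hw, hz⟩
  · exact P.center_mem_skeleton u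
  · exact P.segment_subset_skeleton hw (openSegment_subset_segment _ _ _ hz)

/-- Every point of the skeleton lies on the relatively open star of some vertex at distance at most
one half. -/
theorem exists_onOpenEdge {z : Plane} (hz : z ∈ P.skeleton) :
    ∃ u, P.OnOpenEdge u z ∧ dist z (P.center u) ≤ 1 / 2 := by
  rcases hz with ⟨v, rfl⟩ | ⟨v, w, hvw, hz⟩
  · exact ⟨v, Or.inl rfl, by simp⟩
  · have hd := P.adj_iff.1 hvw
    by_cases h1 : z = P.center v
    · exact ⟨v, Or.inl h1, by simp [h1]⟩
    by_cases h2 : z = P.center w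
    · exact ⟨w, Or.inl h2, by simp [h2]⟩
    have ho := mem_openSegment_of_ne_left_right (Ne.symm h1) (Ne.symm h2) hz
    have hs := dist_add_dist_of_mem_segment hz
    rw [hd] at hs
    by_cases hle : dist z (P.center v) ≤ 1 / 2
    · exact ⟨v, Or.inr ⟨w, hvw, ho⟩, hle⟩
    · refine ⟨w, Or.inr ⟨v, hvw.symm, by rwa [openSegment_symm]⟩, ?_⟩
      rw [dist_comm _ z] at hs
      linarith

/-- Close to a vertex the skeleton consists of the edges at that vertex. -/
theorem onOpenEdge_of_dist_lt {u : V} {z : Plane} (hz : z ∈ P.skeleton)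
    (hd : dist z (P.center u) < 2 / 3) : P.OnOpenEdge u z := by
  rcases hz with ⟨v, rfl⟩ | ⟨v, w, hvw, hz⟩
  · by_cases h : v = u
    · exact Or.inl (by rw [h])
    · linarith [P.one_le_dist h]
  · have key : ∀ {a b : V}, P.graph.Adj a b → z ∈ segment ℝ (P.center a) (P.center b) →
        a = u → P.OnOpenEdge u z := by
      rintro a b hab hz rfl
      by_cases h1 : z = P.center a
      · exact Or.inl h1
      refine Or.inr ⟨b, hab, mem_openSegment_of_ne_left_right (Ne.symm h1) ?_ hz⟩
      rintro rfl
      linarith [P.one_le_dist hab.ne']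
    by_cases h1 : v = u
    · exact key hvw hz h1
    by_cases h2 : w = u
    · exact key hvw.symm (by rwa [segment_symm]) h2
    -- The vertex `u` is a degenerate edge; the radius `2 / 3` works because its square is less than
    -- `1 / 2`.
    have := P.half_le_dist_sq_of_mem_segment (p := z) (q := P.center u) h1 h1 h2 h2
      (P.adj_iff.1 hvw).le (by simp) hz (right_mem_segment _ _ _)
    nlinarith [dist_nonneg (x := z) (y := P.center u)]

/-- Distinct vertices whose open stars share a point of the skeleton are adjacent. -/
theorem OnOpenEdge.eq_or_adj {u w : V} {z : Plane} (hu : P.OnOpenEdge u z)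
    (hw : P.OnOpenEdge w z) : u = w ∨ P.graph.Adj u w := by
  have aux : ∀ {a b : V}, P.graph.Adj a b → z ∈ openSegment ℝ (P.center a) (P.center b) →
      dist z (P.center a) < 1 := by
    intro a b hab hz
    rw [openSegment_eq_image_lineMap] at hz
    obtain ⟨t, ht, rfl⟩ := hz
    rw [dist_lineMap_left, P.adj_iff.1 hab, Real.norm_eq_abs, abs_of_pos ht.1]
    linarith [ht.2]
  rcases hu with rfl | ⟨a, ha, hza⟩
  · rcases hw with h | ⟨b, hb, hzb⟩
    · exact Or.inl (P.center_injective h)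
    · left
      by_contra hne
      have := aux hb hzb
      linarith [P.one_le_dist hne]
  · rcases hw with rfl | ⟨b, hb, hzb⟩
    · left
      by_contra hne
      have := aux ha hza
      linarith [P.one_le_dist (Ne.symm hne)]
    · by_contra hcon
      push Not at hcon
      obtain ⟨h1, h2⟩ := hcon
      have hub : u ≠ b := by rintro rfl; exact h2 hb.symm
      have haw : a ≠ w := by rintro rfl; exact h2 ha
      -- Edges with a common end `a` have unit length, so `z` has the same parameter on both when
      -- measured from `a`, which forces `u = w`. Edges without common end are too far apart to
      -- meet.
      by_cases hab : a = b
      · subst hab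
        have hz : z ≠ P.center a := fun h => by
          have := aux hb hzb
          rw [h, P.adj_iff.1 hb.symm] at this
          exact lt_irrefl _ this
        rw [openSegment_symm, openSegment_eq_image_lineMap] at hza hzb
        obtain ⟨s, hs, rfl⟩ := hza
        obtain ⟨t, ht, hst⟩ := hzb
        have e1 := dist_lineMap_left (P.center a) (P.center u) s
        have e2 := dist_lineMap_left (P.center a) (P.center w) t
        rw [P.adj_iff.1 ha.symm, Real.norm_eq_abs, abs_of_pos hs.1] at e1
        rw [P.adj_iff.1 hb.symm, Real.norm_eq_abs, abs_of_pos ht.1, hst] at e2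
        have : s = t := by linarith
        subst this
        simp only [AffineMap.lineMap_apply_module] at hst
        have h3 := add_left_cancel hst
        exact h1 (P.center_injective (smul_right_injective _ hs.1.ne' h3)).symm
      · have := P.half_le_dist_sq_of_mem_segment (p := z) (q := z) h1 hub haw hab
          (P.adj_iff.1 ha).le (P.adj_iff.1 hb).le (openSegment_subset_segment _ _ _ hza)
          (openSegment_subset_segment _ _ _ hzb)
        norm_num at this

/-- Points in different relatively open cells without common vertex are far apart. -/
theorem half_le_dist_of_onOpenEdge {u w : V} {p q : Plane} (hu : P.OnOpenEdge u p)
    (hw : P.OnOpenEdge w q) (h : ∀ v, P.OnOpenEdge v p → ¬ P.OnOpenEdge v q) :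
    1 / 2 ≤ dist p q := by
  have key : ∀ {u : V} {p : Plane}, P.OnOpenEdge u p → ∃ a b, P.OnOpenEdge a p ∧ P.OnOpenEdge b p ∧
      dist (P.center a) (P.center b) ≤ 1 ∧ p ∈ segment ℝ (P.center a) (P.center b) := by
    intro u p hu
    rcases hu with h | ⟨b, hb, hp⟩
    · exact ⟨u, u, Or.inl h, Or.inl h, by simp, by rw [h]; exact left_mem_segment _ _ _⟩
    · exact ⟨u, b, Or.inr ⟨b, hb, hp⟩, Or.inr ⟨u, hb.symm, by rwa [openSegment_symm]⟩,
        (P.adj_iff.1 hb).le, openSegment_subset_segment _ _ _ hp⟩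
  obtain ⟨a, b, ha, hb, hab, hp⟩ := key hu
  obtain ⟨c, d, hc, hd, hcd, hq⟩ := key hw
  have ne : ∀ {x y : V}, P.OnOpenEdge x p → P.OnOpenEdge y q → x ≠ y := by
    rintro x y hx hy rfl
    exact h x hx hy
  have := P.half_le_dist_sq_of_mem_segment (ne ha hc) (ne ha hd) (ne hb hc) (ne hb hd) hab hcd hp hq
  nlinarith [dist_nonneg (x := p) (y := q)]

end PennyConfiguration

/-! ### Faces, open stars and boundary vertices. -/

theorem eq_lineMap_div_of_lineMap_eq {E : Type*} [AddCommGroup E] [Module ℝ E] {a b z : E}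
    {s t : ℝ} (ht : t ≠ 0) (h : AffineMap.lineMap a b s = AffineMap.lineMap a z t) :
    z = AffineMap.lineMap a b (s / t) := by
  simp only [AffineMap.lineMap_apply_module'] at h ⊢
  have h' := add_right_cancel h
  rw [div_eq_inv_mul, mul_smul, h', smul_smul, inv_mul_cancel₀ ht, one_smul, sub_add_cancel]

namespace PennyConfiguration

variable {V : Type*} (P : PennyConfiguration V)

/-- The skeleton is locally a finite union of compact segments: an edge meeting the unit disk at `z`
has both ends within 2 of `z`. Diagonal pairs in `F` account for the vertices. -/
theorem isClosed_skeleton : IsClosed P.skeleton := by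
  refine isClosed_of_closure_subset fun z hz => ?_
  let F : Set (V × V) := {e | dist (P.center e.1) z ≤ 2 ∧ dist (P.center e.2) z ≤ 2 ∧
    (e.1 = e.2 ∨ P.graph.Adj e.1 e.2)}
  have hF : F.Finite := ((P.finite_setOf_dist_le z 2).prod (P.finite_setOf_dist_le z 2)).subset
    fun e he => ⟨he.1, he.2.1⟩
  let T : Set Plane := ⋃ e ∈ F, segment ℝ (P.center e.1) (P.center e.2)
  have hT : IsClosed T := hF.isClosed_biUnion fun e _ => by
    rw [segment_eq_image_lineMap]
    exact (isCompact_Icc.image AffineMap.lineMap_continuous).isClosed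
  have hTS : T ⊆ P.skeleton := by
    refine iUnion₂_subset fun e he => ?_
    rcases he.2.2 with h | h
    · rw [h, segment_same, singleton_subset_iff]
      exact P.center_mem_skeleton _
    · exact P.segment_subset_skeleton h
  have hST : P.skeleton ∩ Metric.ball z 1 ⊆ T := by
    rintro p ⟨hp | ⟨v, w, hvw, hp⟩, hpz⟩
    · obtain ⟨v, rfl⟩ := hp
      have : dist (P.center v) z ≤ 2 := by linarith [Metric.mem_ball.1 hpz]
      exact mem_biUnion (x := (v, v)) ⟨this, this, Or.inl rfl⟩ (left_mem_segment _ _ _)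
    · have hs := dist_add_dist_of_mem_segment hp
      rw [P.adj_iff.1 hvw] at hs
      have hpz := Metric.mem_ball.1 hpz
      refine mem_biUnion (x := (v, w)) ⟨?_, ?_, Or.inr hvw⟩ hp
      · linarith [dist_triangle (P.center v) p z, dist_nonneg (x := p) (y := P.center w)]
      · linarith [dist_triangle_left (P.center w) z p, dist_nonneg (x := P.center v) (y := p),
          dist_comm (P.center w) z]
  apply hTS
  rw [← hT.closure_eq]
  refine closure_mono hST ?_
  rw [inter_comm]
  exact Metric.isOpen_ball.inter_closure ⟨Metric.mem_ball_self one_pos, hz⟩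

/-- The face containing a point off the skeleton. -/
def face (z : Plane) : Set Plane := connectedComponentIn P.skeletonᶜ z

theorem isOpen_face (z : Plane) : IsOpen (P.face z) :=
  P.isClosed_skeleton.isOpen_compl.connectedComponentIn

theorem mem_face {z : Plane} (hz : z ∉ P.skeleton) : z ∈ P.face z :=
  mem_connectedComponentIn hz

theorem face_subset (z : Plane) : P.face z ⊆ P.skeletonᶜ := connectedComponentIn_subset _ _

theorem isFace_face {z : Plane} (hz : z ∉ P.skeleton) : P.IsFace (P.face z) := ⟨z, hz, rfl⟩

theorem isPreconnected_face (z : Plane) : IsPreconnected (P.face z) :=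
  isPreconnected_connectedComponentIn

theorem face_eq {z x : Plane} (hx : x ∈ P.face z) : P.face z = P.face x :=
  connectedComponentIn_eq hx

theorem closure_face_subset (z : Plane) : closure (P.face z) ⊆ P.face z ∪ P.skeleton := by
  intro x hx
  by_contra h
  simp only [mem_union, not_or] at h
  obtain ⟨y, hy, hy'⟩ := mem_closure_iff.1 hx _ (P.isOpen_face x) (P.mem_face h.2)
  apply h.1
  rw [P.face_eq hy', ← P.face_eq hy]
  exact P.mem_face h.2

/-- A vertex visible from `z` lies in the closure of the face of `z`. -/
theorem center_mem_closure_face {u : V} {z : Plane}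
    (h : ∀ t ∈ Ioc (0 : ℝ) 1, AffineMap.lineMap (P.center u) z t ∉ P.skeleton) :
    P.center u ∈ closure (P.face z) := by
  have hK : IsPreconnected (AffineMap.lineMap (P.center u) z '' Ioc (0 : ℝ) 1) :=
    isPreconnected_Ioc.image _ AffineMap.lineMap_continuous.continuousOn
  have hsub : AffineMap.lineMap (P.center u) z '' Ioc (0 : ℝ) 1 ⊆ P.face z := by
    refine hK.subset_connectedComponentIn ⟨1, by simp, by simp⟩ ?_
    rintro _ ⟨t, ht, rfl⟩
    exact h t ht
  refine closure_mono hsub ?_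
  have h0 : (0 : ℝ) ∈ closure (Ioc (0 : ℝ) 1) := by
    rw [closure_Ioc (by norm_num)]
    simp
  have := mem_closure_image
    (AffineMap.lineMap_continuous (p := P.center u) (q := z) (R := ℝ)).continuousAt h0
  simpa using this

/-- The open star of a vertex: the union of the open cells incident to it. -/
def star (u : V) : Set Plane :=
  {z | P.OnOpenEdge u z ∨ z ∉ P.skeleton ∧ P.center u ∈ closure (P.face z)}

theorem ball_subset_star (u : V) : Metric.ball (P.center u) (2 / 3) ⊆ P.star u := by
  intro z hz
  rw [Metric.mem_ball] at hz
  by_cases hzS : z ∈ P.skeleton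
  · exact Or.inl (P.onOpenEdge_of_dist_lt hzS hz)
  -- Near `u` the skeleton consists of radii, so a skeleton point on the segment from the center to
  -- `z` would put `z` itself on the skeleton.
  refine Or.inr ⟨hzS, P.center_mem_closure_face fun t ht hm => hzS ?_⟩
  have hd : dist (AffineMap.lineMap (P.center u) z t) (P.center u) < 2 / 3 := by
    rw [dist_lineMap_left, Real.norm_eq_abs, abs_of_pos ht.1, dist_comm]
    nlinarith [ht.2, ht.1, dist_nonneg (x := z) (y := P.center u)]
  rcases P.onOpenEdge_of_dist_lt hm hd with h | ⟨w, hw, hmw⟩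
  · have := eq_lineMap_div_of_lineMap_eq ht.1.ne' ((AffineMap.lineMap_apply_zero _ z).trans h.symm)
    rw [zero_div, AffineMap.lineMap_apply_zero] at this
    rw [this]
    exact P.center_mem_skeleton u
  · rw [openSegment_eq_image_lineMap] at hmw
    obtain ⟨s, hs, hsm⟩ := hmw
    have hz' := eq_lineMap_div_of_lineMap_eq ht.1.ne' hsm
    apply P.segment_subset_skeleton hw
    rw [segment_eq_image_lineMap]
    refine ⟨s / t, ⟨div_nonneg hs.1.le ht.1.le, ?_⟩, hz'.symm⟩
    rw [hz', dist_lineMap_left, P.adj_iff.1 hw, Real.norm_eq_abs, mul_one] at hz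
    linarith [le_abs_self (s / t)]

/-- An open neighborhood of the relative interior of the segment from `a` to `b`, the intersection
of two open cones. -/
def lens (a b : Plane) : Set Plane :=
  {z | 3 / 4 * ‖z - a‖ < inner ℝ (z - a) (b - a) ∧ 3 / 4 * ‖z - b‖ < inner ℝ (z - b) (a - b)}

theorem isOpen_lens (a b : Plane) : IsOpen (lens a b) := by
  refine IsOpen.and ?_ ?_ <;> exact isOpen_lt (by fun_prop) (by fun_prop)

theorem lens_comm (a b : Plane) : lens a b = lens b a := inter_comm _ _

theorem inner_sub_add_inner_sub (a b z : Plane) :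
    inner ℝ (z - a) (b - a) + inner ℝ (z - b) (a - b) = dist a b ^ 2 := by
  rw [← neg_sub b a, inner_neg_right, ← sub_eq_add_neg, ← inner_sub_left, sub_sub_sub_cancel_left,
    real_inner_self_eq_norm_sq, dist_comm, dist_eq_norm]

theorem openSegment_subset_lens {a b : Plane} (h : dist a b = 1) :
    openSegment ℝ a b ⊆ lens a b := by
  have key : ∀ {a b : Plane}, dist a b = 1 → ∀ s : ℝ, 0 < s →
      3 / 4 * ‖AffineMap.lineMap a b s - a‖ < inner ℝ (AffineMap.lineMap a b s - a) (b - a) := by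
    intro a b h s hs
    rw [AffineMap.lineMap_apply_module', add_sub_cancel_right, real_inner_smul_left,
      real_inner_self_eq_norm_sq, norm_smul, ← dist_eq_norm, dist_comm b a, h, Real.norm_eq_abs,
      abs_of_pos hs]
    linarith
  rw [openSegment_eq_image_lineMap]
  rintro _ ⟨s, hs, rfl⟩
  refine ⟨key h s hs.1, ?_⟩
  rw [← AffineMap.lineMap_apply_one_sub]
  exact key (by rwa [dist_comm]) _ (by linarith [hs.2])

/-- The two inner products defining the lens sum to 1, so one is at most `1 / 2`; then `z` is within
`(1 / 2) / (3 / 4) = 2 / 3` of that endpoint, where only edges at the endpoint occur. Any other such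
edge makes an angle of at least 60° with the given one, and its cosine `≤ 1 / 2` is excluded by the
cone constant `3 / 4`. -/
theorem lens_inter_skeleton_subset {u w : V} (h : P.graph.Adj u w) :
    lens (P.center u) (P.center w) ∩ P.skeleton ⊆ segment ℝ (P.center u) (P.center w) := by
  have key : ∀ {u w : V} {z : Plane}, P.graph.Adj u w → z ∈ lens (P.center u) (P.center w) →
      z ∈ P.skeleton → inner ℝ (z - P.center u) (P.center w - P.center u) ≤ 1 / 2 →
      z ∈ segment ℝ (P.center u) (P.center w) := by
    intro u w z huw hz hzS hle
    have hd : dist z (P.center u) < 2 / 3 := by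
      rw [dist_eq_norm]
      linarith [hz.1]
    rcases P.onOpenEdge_of_dist_lt hzS hd with rfl | ⟨b, hb, hzb⟩
    · simp [lens] at hz
    · by_cases hbw : b = w
      · subst hbw
        exact openSegment_subset_segment _ _ _ hzb
      exfalso
      rw [openSegment_eq_image_lineMap] at hzb
      obtain ⟨s, hs, rfl⟩ := hzb
      have h1 := hz.1
      have h2 : ‖P.center b - P.center u‖ = 1 := by
        rw [← dist_eq_norm, dist_comm]; exact P.adj_iff.1 hb
      have h3 : ‖P.center w - P.center u‖ = 1 := by
        rw [← dist_eq_norm, dist_comm]; exact P.adj_iff.1 huw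
      rw [AffineMap.lineMap_apply_module', add_sub_cancel_right, real_inner_smul_left, norm_smul,
        h2, Real.norm_eq_abs, abs_of_pos hs.1] at h1
      have h4 := P.one_le_dist hbw
      have h5 := norm_sub_sq_real (P.center b - P.center u) (P.center w - P.center u)
      rw [sub_sub_sub_cancel_right, ← dist_eq_norm, h2, h3] at h5
      have h6 : inner ℝ (P.center b - P.center u) (P.center w - P.center u) ≤ 1 / 2 := by
        nlinarith
      nlinarith [hs.1]
  rintro z ⟨hz, hzS⟩
  have hsum := inner_sub_add_inner_sub (P.center u) (P.center w) z
  rw [P.adj_iff.1 h] at hsum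
  by_cases hle : inner ℝ (z - P.center u) (P.center w - P.center u) ≤ 1 / 2
  · exact key h hz hzS hle
  · rw [segment_symm]
    rw [lens_comm] at hz
    exact key h.symm hz hzS (by linarith)

/-- After its start, the segment from the center of `u` to `z` stays in the lens, where the skeleton
is just the edge; so it misses the skeleton unless `z` lies on the edge. -/
theorem lens_subset_star {u w : V} (h : P.graph.Adj u w) :
    lens (P.center u) (P.center w) ⊆ P.star u := by
  intro z hz
  by_cases hzS : z ∈ P.skeleton
  · refine Or.inl (Or.inr ⟨w, h, mem_openSegment_of_ne_left_right ?_ ?_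
      (P.lens_inter_skeleton_subset h ⟨hz, hzS⟩)⟩)
    · rintro rfl
      simp [lens] at hz
    · rintro rfl
      simp [lens] at hz
  refine Or.inr ⟨hzS, P.center_mem_closure_face fun t ht hm => hzS ?_⟩
  have huw : ‖P.center w - P.center u‖ = 1 := by
    rw [← dist_eq_norm, dist_comm]; exact P.adj_iff.1 h
  have hmQ : AffineMap.lineMap (P.center u) z t ∈ lens (P.center u) (P.center w) := by
    refine ⟨?_, ?_⟩
    · rw [AffineMap.lineMap_apply_module', add_sub_cancel_right, real_inner_smul_left, norm_smul,
        Real.norm_eq_abs, abs_of_pos ht.1]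
      nlinarith [hz.1, ht.1]
    · have e : AffineMap.lineMap (P.center u) z t - P.center w =
          (1 - t) • (P.center u - P.center w) + t • (z - P.center w) := by
        rw [AffineMap.lineMap_apply_module]
        module
      have h1 : ‖AffineMap.lineMap (P.center u) z t - P.center w‖ ≤
          (1 - t) + t * ‖z - P.center w‖ := by
        rw [e]
        refine (norm_add_le _ _).trans_eq ?_
        rw [norm_smul, norm_smul, norm_sub_rev (P.center u), huw, Real.norm_eq_abs,
          Real.norm_eq_abs, abs_of_pos ht.1, abs_of_nonneg (by linarith [ht.2]), mul_one]
      have h2 : inner ℝ (AffineMap.lineMap (P.center u) z t - P.center w)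
          (P.center u - P.center w) =
          (1 - t) + t * inner ℝ (z - P.center w) (P.center u - P.center w) := by
        rw [e, inner_add_left, real_inner_smul_left, real_inner_smul_left,
          real_inner_self_eq_norm_sq, norm_sub_rev, huw]
        ring
      rw [h2]
      nlinarith [hz.2, ht.1, ht.2]
  have hms := P.lens_inter_skeleton_subset h ⟨hmQ, hm⟩
  rw [segment_eq_image_lineMap] at hms
  obtain ⟨s, hs, hsm⟩ := hms
  have hz' := eq_lineMap_div_of_lineMap_eq ht.1.ne' hsm
  apply P.segment_subset_skeleton h
  rw [segment_eq_image_lineMap]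
  refine ⟨s / t, ⟨div_nonneg hs.1 ht.1.le, ?_⟩, hz'.symm⟩
  have h1 := inner_sub_add_inner_sub (P.center u) (P.center w) z
  have h2 := hz.2
  have h3 : inner ℝ (z - P.center u) (P.center w - P.center u) = s / t := by
    rw [hz', AffineMap.lineMap_apply_module', add_sub_cancel_right, real_inner_smul_left,
      real_inner_self_eq_norm_sq, huw]
    ring
  rw [P.adj_iff.1 h, h3] at h1
  linarith [norm_nonneg (z - P.center w)]

theorem isOpen_star (u : V) : IsOpen (P.star u) := by
  rw [isOpen_iff_forall_mem_open]
  rintro z ((rfl | ⟨w, hw, hz⟩) | ⟨hz, hu⟩)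
  · exact ⟨_, P.ball_subset_star u, Metric.isOpen_ball, Metric.mem_ball_self (by norm_num)⟩
  · exact ⟨_, P.lens_subset_star hw, isOpen_lens _ _, openSegment_subset_lens (P.adj_iff.1 hw) hz⟩
  · refine ⟨_, fun x hx => Or.inr ⟨P.face_subset z hx, ?_⟩, P.isOpen_face z, P.mem_face hz⟩
    rwa [← P.face_eq hx]

/-- The vertices on the boundary of a set. -/
def boundaryVertices (σ : Set Plane) : Set V := {u | P.center u ∈ closure σ}

theorem mem_boundaryVertices_of_mem_star {u : V} {q z : Plane} (hq : q ∈ P.star u)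
    (hqz : q ∈ closure (P.face z)) : u ∈ P.boundaryVertices (P.face z) := by
  obtain ⟨x, hxu, hxz⟩ := mem_closure_iff.1 hqz _ (P.isOpen_star u) hq
  rcases hxu with hx | ⟨-, hx⟩
  · exact absurd hx.mem_skeleton (P.face_subset z hxz)
  · rwa [← P.face_eq hxz] at hx

/-- The penny at a boundary vertex meets the face, and the sector through a common point is a corner
there. A vertex may have several corners, so only an inequality holds. -/
theorem encard_boundaryVertices_le (z : Plane) :
    (P.boundaryVertices (P.face z)).encard ≤ P.facialDegree (P.face z) := by
  have hex : ∀ u ∈ P.boundaryVertices (P.face z), ∃ A, (u, A) ∈ P.corners (P.face z) := by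
    intro u hu
    obtain ⟨x, hxu, hxz⟩ := mem_closure_iff.1 hu (Metric.ball (P.center u) (1 / 2))
      Metric.isOpen_ball (Metric.mem_ball_self (by norm_num))
    refine ⟨connectedComponentIn (P.penny u \ P.skeleton) x, ⟨x, ⟨hxu, P.face_subset z hxz⟩, rfl⟩, ?_⟩
    rw [P.face_eq hxz]
    exact connectedComponentIn_mono x fun y hy => hy.2
  choose! A hA using hex
  refine encard_le_encard_of_injOn (f := fun u => (u, A u)) hA ?_
  intro u _ v _ huv
  exact (Prod.mk.inj huv).1

end PennyConfiguration

/-! ### Connected frontiers and bounded faces. -/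

/-- Every ray from a point of a bounded set meets the frontier. -/
theorem exists_mem_frontier_ray {E : Type*} [NormedAddCommGroup E] [NormedSpace ℝ E] {s : Set E}
    (hs : Bornology.IsBounded s) {z e : E} (hz : z ∈ s) (he : e ≠ 0) :
    ∃ t : ℝ, 0 ≤ t ∧ z + t • e ∈ frontier s := by
  by_contra! hcon
  have hK : IsPreconnected ((fun t : ℝ => z + t • e) '' Ici 0) :=
    isPreconnected_Ici.image _ (Continuous.continuousOn (by fun_prop))
  have hsub := hK.subset_of_disjoint_frontier (s := s) ⟨z, ⟨0, by simp, by simp⟩, hz⟩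
    (disjoint_left.2 (by rintro _ ⟨t, ht, rfl⟩; exact hcon t ht))
  obtain ⟨R, hR⟩ := hs.exists_norm_le
  have he' := norm_pos_iff.2 he
  have hR0 : 0 ≤ R := (norm_nonneg z).trans (hR z hz)
  let t := (R + ‖z‖ + 1) / ‖e‖
  have ht : 0 ≤ t := by positivity
  have h1 := hR _ (hsub ⟨t, ht, rfl⟩)
  have h2 : ‖t • e‖ = R + ‖z‖ + 1 := by
    rw [norm_smul, Real.norm_eq_abs, abs_of_nonneg ht, div_mul_cancel₀ _ he'.ne']
  have h3 := norm_sub_le (z + t • e) z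
  rw [add_sub_cancel_left, h2] at h3
  linarith

/-- A segment leaving an open set contains a point of its frontier. -/
theorem exists_mem_segment_frontier {E : Type*} [NormedAddCommGroup E] [NormedSpace ℝ E] {U : Set E}
    (hU : IsOpen U) {p y : E} (hp : p ∈ U) (hy : y ∉ U) :
    ∃ q ∈ segment ℝ p y, q ∈ closure U ∧ q ∉ U := by
  have hseg : IsPreconnected (segment ℝ p y) := (convex_segment p y).isPreconnected
  by_contra! hcon
  refine hy (hseg.subset_of_disjoint_frontier ⟨p, left_mem_segment ℝ p y, hp⟩
    (disjoint_left.2 fun q hq hq' => ?_) (right_mem_segment ℝ p y))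
  rw [hU.frontier_eq] at hq'
  exact hq'.2 (hcon q hq hq'.1)

namespace PennyConfiguration

variable {V : Type*} (P : PennyConfiguration V)

theorem dist_center_le_length {x y : V} (p : P.graph.Walk x y) :
    dist (P.center x) (P.center y) ≤ p.length := by
  induction p with
  | nil => simp
  | @cons a b c h p ih =>
    rw [SimpleGraph.Walk.length_cons]
    push_cast
    linarith [dist_triangle (P.center a) (P.center b) (P.center c), P.adj_iff.1 h]

theorem dist_center_le_combDist (hconn : P.graph.Connected) (x y : V) :
    dist (P.center x) (P.center y) ≤ P.combDist x y := by
  obtain ⟨p, hp⟩ := hconn.exists_walk_length_eq_dist x y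
  have := P.dist_center_le_length p
  rwa [hp] at this

theorem isPreconnected_skeleton (hconn : P.graph.Connected) : IsPreconnected P.skeleton := by
  obtain ⟨x⟩ := hconn.nonempty
  have hv : ∀ y, JoinedIn P.skeleton (P.center x) (P.center y) := by
    intro y
    obtain ⟨p⟩ := hconn.preconnected x y
    induction p with
    | nil => exact JoinedIn.refl (P.center_mem_skeleton _)
    | cons h p ih => exact (JoinedIn.of_segment_subset (P.segment_subset_skeleton h)).trans ih
  refine IsConnected.isPreconnected (IsPathConnected.isConnected
    ⟨P.center x, P.center_mem_skeleton x, ?_⟩)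
  rintro z (⟨v, rfl⟩ | ⟨v, w, hvw, hz⟩)
  · exact hv v
  · refine (hv v).trans (JoinedIn.of_segment_subset (Subset.trans ?_ (P.segment_subset_skeleton hvw)))
    exact (convex_segment _ _).segment_subset (left_mem_segment _ _ _) hz

theorem frontier_face_subset (z : Plane) : frontier (P.face z) ⊆ P.skeleton := by
  rw [(P.isOpen_face z).frontier_eq]
  rintro x ⟨hx, hx'⟩
  exact (P.closure_face_subset z hx).resolve_left hx'

/-- The complement is the union of the connected skeleton and the closures of the other faces, each
of which meets the skeleton in its nonempty frontier. -/
theorem isPreconnected_compl_face (hconn : P.graph.Connected) (z : Plane) :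
    IsPreconnected (P.face z)ᶜ := by
  obtain ⟨x⟩ := hconn.nonempty
  have hS : P.skeleton ⊆ (P.face z)ᶜ := fun p hp hpz => P.face_subset z hpz hp
  refine isPreconnected_of_forall (P.center x) fun y hy => ?_
  by_cases hyS : y ∈ P.skeleton
  · exact ⟨P.skeleton, hS, P.center_mem_skeleton x, hyS, P.isPreconnected_skeleton hconn⟩
  refine ⟨P.skeleton ∪ closure (P.face y), union_subset hS fun p hp => ?_,
    Or.inl (P.center_mem_skeleton x), Or.inr (subset_closure (P.mem_face hyS)), ?_⟩
  · rcases P.closure_face_subset y hp with hp | hp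
    · intro hpz
      apply hy
      rw [P.face_eq hpz, ← P.face_eq hp]
      exact P.mem_face hyS
    · exact hS hp
  · obtain ⟨q, hq⟩ : (frontier (P.face y)).Nonempty := by
      rw [nonempty_frontier_iff]
      refine ⟨⟨y, P.mem_face hyS⟩, fun h => ?_⟩
      exact P.face_subset y (h ▸ mem_univ (P.center x)) (P.center_mem_skeleton x)
    exact (P.isPreconnected_skeleton hconn).union q (P.frontier_face_subset y hq)
      (frontier_subset_closure hq) (P.isPreconnected_face y).closure

theorem isPreconnected_frontier_face (hconn : P.graph.Connected) (z : Plane) :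
    IsPreconnected (frontier (P.face z)) := by
  rw [(P.isOpen_face z).frontier_eq, sdiff_eq]
  refine isPreconnected_inter_of_union_eq_univ isClosed_closure (P.isOpen_face z).isClosed_compl
    (P.isPreconnected_face z).closure (P.isPreconnected_compl_face hconn z) ?_
  rw [eq_univ_iff_forall]
  intro x
  by_cases hx : x ∈ P.face z
  · exact Or.inl (subset_closure hx)
  · exact Or.inr hx

theorem exists_boundaryVertex_of_mem_frontier {q z : Plane} (hq : q ∈ frontier (P.face z)) :
    ∃ u ∈ P.boundaryVertices (P.face z), P.OnOpenEdge u q ∧ dist q (P.center u) ≤ 1 / 2 := by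
  obtain ⟨u, hu, hd⟩ := P.exists_onOpenEdge (P.frontier_face_subset z hq)
  exact ⟨u, P.mem_boundaryVertices_of_mem_star (Or.inl hu) (frontier_subset_closure hq), hu, hd⟩

/-- The frontier stays within `1 / 2` of finitely many centers. An unbounded face would then contain
the whole exterior of a large disk, leaving room for only finitely many centers. -/
theorem isBounded_face [Infinite V] {z : Plane}
    (hfin : (P.boundaryVertices (P.face z)).Finite) : Bornology.IsBounded (P.face z) := by
  have hb : Bornology.IsBounded (frontier (P.face z)) := by
    refine ((Bornology.isBounded_biUnion hfin).2 fun u _ =>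
      Metric.isBounded_closedBall (x := P.center u) (r := 1 / 2)).subset fun q hq => ?_
    obtain ⟨u, hu, -, hd⟩ := P.exists_boundaryVertex_of_mem_frontier hq
    exact mem_biUnion hu hd
  obtain ⟨R, hR0, hR⟩ := hb.subset_closedBall_lt 0 0
  by_contra hcon
  have hne : ((Metric.closedBall (0 : Plane) R)ᶜ ∩ P.face z).Nonempty := by
    by_contra hemp
    refine hcon (Metric.isBounded_closedBall (x := (0 : Plane)) (r := R) |>.subset fun x hx => ?_)
    by_contra hx'
    exact hemp ⟨x, hx', hx⟩
  have hsub := (isPreconnected_compl_closedBall_zero (E := Plane)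
    (by rw [← Module.finrank_eq_rank]; simp) hR0.le).subset_of_disjoint_frontier
    hne (disjoint_compl_left.mono_right hR)
  refine infinite_univ (α := V) ((P.finite_setOf_dist_le 0 R).subset fun v _ => ?_)
  by_contra hv
  exact P.face_subset z (hsub hv) (P.center_mem_skeleton v)

theorem reachable_induce_boundaryVertices (hconn : P.graph.Connected) (z : Plane)
    (u w : P.boundaryVertices (P.face z)) :
    (P.graph.induce (P.boundaryVertices (P.face z))).Reachable u w := by
  by_contra hcon
  set H := P.graph.induce (P.boundaryVertices (P.face z))
  have hfr : ∀ v : P.boundaryVertices (P.face z), P.center v ∈ frontier (P.face z) := fun v => by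
    rw [(P.isOpen_face z).frontier_eq]
    exact ⟨v.2, fun h => P.face_subset z h (P.center_mem_skeleton v)⟩
  -- The stars of the vertices reachable from `u`, and those of the others, form two open sets
  -- covering the connected frontier; a common point gives an equality or an edge between the two
  -- classes.
  obtain ⟨q, hq, h1, h2⟩ := P.isPreconnected_frontier_face hconn z
    (⋃ v ∈ {v | H.Reachable u v}, P.star v) (⋃ v ∈ {v | ¬ H.Reachable u v}, P.star v)
    (isOpen_biUnion fun v _ => P.isOpen_star v) (isOpen_biUnion fun v _ => P.isOpen_star v)
    (fun q hq => by
      obtain ⟨v, hv, hvq, -⟩ := P.exists_boundaryVertex_of_mem_frontier hq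
      by_cases h : H.Reachable u ⟨v, hv⟩
      · exact Or.inl (mem_biUnion (x := (⟨v, hv⟩ : P.boundaryVertices (P.face z))) h (Or.inl hvq))
      · exact Or.inr (mem_biUnion (x := (⟨v, hv⟩ : P.boundaryVertices (P.face z))) h (Or.inl hvq)))
    ⟨P.center u, hfr u, mem_biUnion (x := u) (SimpleGraph.Reachable.refl u) (Or.inl (Or.inl rfl))⟩
    ⟨P.center w, hfr w, mem_biUnion (x := w) hcon (Or.inl (Or.inl rfl))⟩
  obtain ⟨a, ha, hqa⟩ := mem_iUnion₂.1 h1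
  obtain ⟨b, hb, hqb⟩ := mem_iUnion₂.1 h2
  have hqS := P.frontier_face_subset z hq
  rcases OnOpenEdge.eq_or_adj P (hqa.resolve_right fun h => h.1 hqS)
    (hqb.resolve_right fun h => h.1 hqS) with h | h
  · exact hb (Subtype.ext h ▸ ha)
  · exact hb (SimpleGraph.Reachable.trans ha (SimpleGraph.Adj.reachable (G := H) h))

theorem dist_lt_ncard_boundaryVertices (hconn : P.graph.Connected) {z : Plane}
    (hfin : (P.boundaryVertices (P.face z)).Finite) {u w : V}
    (hu : u ∈ P.boundaryVertices (P.face z)) (hw : w ∈ P.boundaryVertices (P.face z)) :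
    P.graph.dist u w + 1 ≤ (P.boundaryVertices (P.face z)).ncard := by
  have := hfin.fintype
  obtain ⟨p, hp⟩ :=
    (P.reachable_induce_boundaryVertices hconn z ⟨u, hu⟩ ⟨w, hw⟩).exists_isPath
  have h1 := hp.length_lt
  have h2 := SimpleGraph.dist_le (p.map (SimpleGraph.Embedding.induce _).toHom)
  rw [SimpleGraph.Walk.length_map] at h2
  rw [← Nat.card_coe_set_eq, Nat.card_eq_fintype_card]
  exact (Nat.add_le_add_right h2 1).trans h1

/-! ### Comparison of combinatorial and Euclidean distance. -/

/-- Next to an edge there is a point off the skeleton lying in the stars of both endpoints. -/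
theorem exists_notMem_skeleton_mem_star {u w : V} (h : P.graph.Adj u w) :
    ∃ z, z ∉ P.skeleton ∧ z ∈ P.star u ∧ z ∈ P.star w := by
  set a := P.center w - P.center u with ha
  -- The edge vector turned by a right angle; the point sought is the midpoint moved slightly along
  -- `n`.
  let n : Plane := !₂[-a 1, a 0]
  have han : inner ℝ a n = 0 := by
    simp [n, PiLp.inner_apply, Fin.sum_univ_two]
    ring
  have hn : inner ℝ n n ≠ (0 : ℝ) := by
    have h1 : inner ℝ n n = inner ℝ a a := by
      simp only [n, PiLp.inner_apply, Fin.sum_univ_two]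
      simp
      ring
    rw [h1, real_inner_self_eq_norm_sq, ha, ← dist_eq_norm, dist_comm, P.adj_iff.1 h]
    norm_num
  let m : Plane := AffineMap.lineMap (P.center u) (P.center w) (1 / 2 : ℝ)
  have hm : m + (0 : ℝ) • n ∈ lens (P.center u) (P.center w) := by
    refine openSegment_subset_lens (P.adj_iff.1 h) ?_
    rw [openSegment_eq_image_lineMap]
    exact ⟨1 / 2, by norm_num, by simp [m]⟩
  have hev : ∀ᶠ ε : ℝ in 𝓝 0, m + ε • n ∈ lens (P.center u) (P.center w) :=
    (Continuous.continuousAt (by fun_prop)).preimage_mem_nhds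
      ((isOpen_lens (P.center u) (P.center w)).mem_nhds hm)
  obtain ⟨ε, hε, hε0⟩ :=
    ((hev.filter_mono nhdsWithin_le_nhds).and (self_mem_nhdsWithin (a := (0 : ℝ)) (s := {0}ᶜ))).exists
  refine ⟨m + ε • n, fun hS => ?_, P.lens_subset_star h hε,
    P.lens_subset_star h.symm (by rwa [lens_comm])⟩
  have hseg := P.lens_inter_skeleton_subset h ⟨hε, hS⟩
  rw [segment_eq_image_lineMap] at hseg
  obtain ⟨s, -, hs⟩ := hseg
  have h1 : ε • n = (s - 1 / 2) • a := by
    simp only [m, AffineMap.lineMap_apply_module', ← ha] at hs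
    rw [sub_smul, eq_sub_iff_add_eq, ← add_right_cancel_iff (a := P.center u), hs]
    abel
  have h2 := congrArg (fun v => inner ℝ v n) h1
  simp only [real_inner_smul_left, han, mul_zero] at h2
  rcases mul_eq_zero.1 h2 with h3 | h3
  · exact hε0 h3
  · exact hn h3

theorem OnOpenEdge.eq_of_center {u v : V} (h : P.OnOpenEdge v (P.center u)) : v = u := by
  by_contra hne
  rcases h with h | ⟨w, hw, hu⟩
  · exact hne (P.center_injective h.symm)
  · rw [openSegment_eq_image_lineMap] at hu
    obtain ⟨t, ht, htu⟩ := hu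
    have h1 := dist_lineMap_left (P.center v) (P.center w) t
    rw [htu, P.adj_iff.1 hw, Real.norm_eq_abs, abs_of_pos ht.1] at h1
    linarith [P.one_le_dist (Ne.symm hne), ht.2]

theorem OnOpenEdge.dist_le_one {u v : V} {p : Plane} (hu : P.OnOpenEdge u p)
    (hv : P.OnOpenEdge v p) : P.graph.dist u v ≤ 1 := by
  rcases OnOpenEdge.eq_or_adj P hu hv with rfl | h
  · simp
  · exact (SimpleGraph.dist_eq_one_iff_adj.2 h).le

/-- Off the skeleton both vertices bound the face of `x`. On the skeleton they are equal or
adjacent, which `2 ≤ D` absorbs. -/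
theorem dist_le_of_star_inter_star {D : ℝ} (hconn : P.graph.Connected) (hD2 : 2 ≤ D)
    (hfin : ∀ z ∉ P.skeleton, (P.boundaryVertices (P.face z)).Finite)
    (hD : ∀ z ∉ P.skeleton, ((P.boundaryVertices (P.face z)).ncard : ℝ) ≤ D) {u w : V} {x : Plane}
    (hu : x ∈ P.star u) (hw : x ∈ P.star w) : (P.graph.dist u w : ℝ) + 1 ≤ D := by
  by_cases hx : x ∈ P.skeleton
  · have h1 := OnOpenEdge.dist_le_one P (hu.resolve_right fun h => h.1 hx)
      (hw.resolve_right fun h => h.1 hx)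
    have h2 : (P.graph.dist u w : ℝ) ≤ 1 := by exact_mod_cast h1
    linarith
  · have hu' := P.mem_boundaryVertices_of_mem_star hu (subset_closure (P.mem_face hx))
    have hw' := P.mem_boundaryVertices_of_mem_star hw (subset_closure (P.mem_face hx))
    have h1 := P.dist_lt_ncard_boundaryVertices hconn (hfin x hx) hu' hw'
    refine le_trans ?_ (hD x hx)
    exact_mod_cast h1

theorem exists_next_cell {u y : V} {p : Plane} (hu : P.OnOpenEdge u p)
    (hy : ¬ P.OnOpenEdge y p) :
    ∃ q v w x, P.OnOpenEdge v p ∧ P.OnOpenEdge w q ∧ x ∈ P.star v ∧ x ∈ P.star w ∧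
      1 / 2 ≤ dist p q ∧ q ∈ segment ℝ p (P.center y) := by
  have hU : IsOpen (⋃ v ∈ {v | P.OnOpenEdge v p}, P.star v) :=
    isOpen_biUnion fun v _ => P.isOpen_star v
  obtain ⟨q, hq, hqc, hqU⟩ := exists_mem_segment_frontier hU (y := P.center y)
    (mem_biUnion (x := u) hu (Or.inl hu)) (fun h => by
      obtain ⟨v, hv, hyv⟩ := mem_iUnion₂.1 h
      have := OnOpenEdge.eq_of_center P
        (hyv.resolve_right fun h => h.1 (P.center_mem_skeleton y))
      exact hy (this ▸ hv))
  -- Off the skeleton, an open star contains the whole face of any of its points, so `q` would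
  -- already lie in the union of stars.
  have hqS : q ∈ P.skeleton := by
    by_contra hqS
    obtain ⟨x, hx, hxU⟩ := mem_closure_iff.1 hqc _ (P.isOpen_face q) (P.mem_face hqS)
    obtain ⟨v, hv, hxv⟩ := mem_iUnion₂.1 hxU
    refine hqU (mem_biUnion (x := v) hv (Or.inr ⟨hqS, ?_⟩))
    rw [P.face_eq hx]
    exact (hxv.resolve_left fun h => P.face_subset q hx h.mem_skeleton).2
  obtain ⟨w, hw, -⟩ := P.exists_onOpenEdge hqS
  obtain ⟨x, hxw, hxU⟩ := mem_closure_iff.1 hqc _ (P.isOpen_star w) (Or.inl hw)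
  obtain ⟨v, hv, hxv⟩ := mem_iUnion₂.1 hxU
  exact ⟨q, v, w, x, hv, hw, hxv, hxw, P.half_le_dist_of_onOpenEdge hu hw fun v hv hvq =>
    hqU (mem_biUnion (x := v) hv (Or.inl hvq)), hq⟩

/-- The additive 1 pays for an arbitrary choice of vertex on the cell of `p`. Starting at a vertex
there is no choice, so that 1 is saved and the final bound has no additive constant. The induction
is on the number of half units left. -/
theorem dist_le_of_onOpenEdge {D : ℝ} (hconn : P.graph.Connected) (hD0 : 0 ≤ D)
    (hD : ∀ u w x, x ∈ P.star u → x ∈ P.star w → (P.graph.dist u w : ℝ) + 1 ≤ D) (y : V) (n : ℕ)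
    (u : V) (p : Plane) (hu : P.OnOpenEdge u p) (hn : dist p (P.center y) ≤ n / 2) :
    (P.graph.dist u y : ℝ) ≤ 2 * D * dist p (P.center y) + 1 ∧
      (p = P.center u → (P.graph.dist u y : ℝ) ≤ 2 * D * dist p (P.center y)) := by
  induction n generalizing u p with
  | zero =>
    have h0 : p = P.center y := dist_le_zero.1 (by simpa using hn)
    subst h0
    have := OnOpenEdge.eq_of_center P hu
    subst this
    simp
  | succ n ih =>
    by_cases hy : P.OnOpenEdge y p
    · have h1 : (P.graph.dist u y : ℝ) ≤ 1 := by exact_mod_cast OnOpenEdge.dist_le_one P hu hy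
      have h2 : 0 ≤ 2 * D * dist p (P.center y) := by positivity
      refine ⟨by linarith, ?_⟩
      rintro rfl
      have := OnOpenEdge.eq_of_center P hy
      subst this
      simp
    obtain ⟨q, v, w, x, hv, hw, hxv, hxw, hpq, hq⟩ := P.exists_next_cell hu hy
    have hs := dist_add_dist_of_mem_segment hq
    push_cast at hn
    have h1 := (ih w q hw (by linarith)).1
    have h2 := hD v w x hxv hxw
    have h3 : (P.graph.dist u y : ℝ) ≤
        P.graph.dist u v + (P.graph.dist v w + P.graph.dist w y) := by
      exact_mod_cast hconn.dist_triangle.trans (Nat.add_le_add_left hconn.dist_triangle _)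
    have h4 : (P.graph.dist u v : ℝ) ≤ 1 := by exact_mod_cast OnOpenEdge.dist_le_one P hu hv
    have h5 : D * (1 / 2) ≤ D * dist p q := mul_le_mul_of_nonneg_left hpq hD0
    rw [← hs]
    refine ⟨by linarith, ?_⟩
    rintro rfl
    have := OnOpenEdge.eq_of_center P hv
    subst this
    rw [SimpleGraph.dist_self, Nat.cast_zero] at h3
    linarith

/-! ### Density of the vertices and conclusion. -/

/-- Let `N` be the number of boundary vertices. The ray from `z` away from a boundary vertex `u`
hits the frontier at `q`, within `1 / 2` of a boundary vertex `w`. The distances of `z` to `u` and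
`q` add up to `dist q u ≤ N - 1 / 2`, so `u` or `w` is within `N / 2` of `z`. -/
theorem exists_dist_center_le_of_notMem_skeleton [Infinite V] (hconn : P.graph.Connected)
    {z : Plane} (hz : z ∉ P.skeleton) (hfin : (P.boundaryVertices (P.face z)).Finite) :
    ∃ x, dist z (P.center x) ≤ (P.boundaryVertices (P.face z)).ncard / 2 := by
  have hb := P.isBounded_face hfin
  obtain ⟨e, he⟩ := exists_ne (0 : Plane)
  obtain ⟨_, _, hq₀⟩ := exists_mem_frontier_ray hb (P.mem_face hz) he
  obtain ⟨u, hu, -, -⟩ := P.exists_boundaryVertex_of_mem_frontier hq₀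
  have hzu : z - P.center u ≠ 0 := fun h => hz (sub_eq_zero.1 h ▸ P.center_mem_skeleton u)
  obtain ⟨t, ht, hq⟩ := exists_mem_frontier_ray hb (P.mem_face hz) hzu
  obtain ⟨w, hw, -, hqw⟩ := P.exists_boundaryVertex_of_mem_frontier hq
  set q := z + t • (z - P.center u) with hq_def
  have h1 : dist q (P.center u) = dist z q + dist z (P.center u) := by
    have e1 : q - P.center u = (t + 1) • (z - P.center u) := by rw [hq_def]; module
    have e2 : z - q = -(t • (z - P.center u)) := by rw [hq_def]; module
    rw [dist_eq_norm, dist_eq_norm, dist_eq_norm, e1, e2, norm_neg, norm_smul, norm_smul,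
      Real.norm_eq_abs, Real.norm_eq_abs, abs_of_nonneg ht, abs_of_nonneg (by linarith)]
    ring
  have h2 : (P.graph.dist w u : ℝ) + 1 ≤ (P.boundaryVertices (P.face z)).ncard := by
    exact_mod_cast P.dist_lt_ncard_boundaryVertices hconn hfin hw hu
  have h3 : dist (P.center w) (P.center u) ≤ P.graph.dist w u := P.dist_center_le_combDist hconn w u
  have h4 := dist_triangle q (P.center w) (P.center u)
  have h5 := dist_triangle z q (P.center w)
  by_cases hle : dist z (P.center u) ≤ (P.boundaryVertices (P.face z)).ncard / 2
  · exact ⟨u, hle⟩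
  · exact ⟨w, by linarith⟩

end PennyConfiguration

theorem theorem3p2 {V : Type*} [Infinite V] (P : PennyConfiguration V)
    (hconn : P.graph.Connected) (D : ℝ≥0)
    (hD : ∀ σ : Set Plane, P.IsFace σ → (P.facialDegree σ : ℝ≥0∞) ≤ (D : ℝ≥0∞)) :
    (∀ x y : V, 1 / (2 * (D : ℝ)) * P.combDist x y ≤ dist (P.center x) (P.center y) ∧
      dist (P.center x) (P.center y) ≤ P.combDist x y) ∧
    (∀ z : Plane, ∃ x : V, dist z (P.center x) ≤ (D : ℝ) / 2) ∧
    IsQuasiIsometryMap P.combDist (dist : Plane → Plane → ℝ) P.center := by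
  have hle : ∀ z ∉ P.skeleton, ((P.boundaryVertices (P.face z)).encard : ℝ≥0∞) ≤ D := fun z hz =>
    (ENat.toENNReal_le.2 (P.encard_boundaryVertices_le z)).trans (hD _ (P.isFace_face hz))
  have hfin : ∀ z ∉ P.skeleton, (P.boundaryVertices (P.face z)).Finite := by
    intro z hz
    rw [← Set.encard_ne_top_iff]
    intro htop
    have := hle z hz
    rw [htop] at this
    simp at this
  have hcard : ∀ z ∉ P.skeleton, ((P.boundaryVertices (P.face z)).ncard : ℝ) ≤ D := by
    intro z hz
    have := hle z hz
    rw [← (hfin z hz).cast_ncard_eq, ENat.toENNReal_coe] at this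
    exact_mod_cast this
  -- A face beside an edge has both ends of the edge among its boundary vertices.
  have hD2 : (2 : ℝ) ≤ D := by
    obtain ⟨u, w, huw⟩ : ∃ u w, P.graph.Adj u w := by
      obtain ⟨u⟩ := hconn.nonempty
      exact ⟨u, hconn.preconnected.exists_adj_of_nontrivial u⟩
    obtain ⟨z, hz, hzu, hzw⟩ := P.exists_notMem_skeleton_mem_star huw
    have h1 := P.dist_lt_ncard_boundaryVertices hconn (hfin z hz)
      (P.mem_boundaryVertices_of_mem_star hzu (subset_closure (P.mem_face hz)))
      (P.mem_boundaryVertices_of_mem_star hzw (subset_closure (P.mem_face hz)))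
    rw [SimpleGraph.dist_eq_one_iff_adj.2 huw] at h1
    refine le_trans ?_ (hcard z hz)
    exact_mod_cast h1
  have hlower : ∀ x y, P.combDist x y ≤ 2 * D * dist (P.center x) (P.center y) := by
    intro x y
    obtain ⟨n, hn⟩ := exists_nat_ge (2 * dist (P.center x) (P.center y))
    exact (P.dist_le_of_onOpenEdge hconn D.2 (fun u w z hu hw =>
      P.dist_le_of_star_inter_star hconn hD2 hfin hcard hu hw) y n x (P.center x) (Or.inl rfl)
      (by linarith)).2 rfl
  have hdense : ∀ z : Plane, ∃ x : V, dist z (P.center x) ≤ (D : ℝ) / 2 := by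
    intro z
    by_cases hz : z ∈ P.skeleton
    · obtain ⟨x, -, hx⟩ := P.exists_onOpenEdge hz
      exact ⟨x, by linarith⟩
    · obtain ⟨x, hx⟩ := P.exists_dist_center_le_of_notMem_skeleton hconn hz (hfin z hz)
      exact ⟨x, by linarith [hcard z hz]⟩
  have hupper := P.dist_center_le_combDist hconn
  have hbound : ∀ x y, 1 / (2 * (D : ℝ)) * P.combDist x y ≤ dist (P.center x) (P.center y) := by
    intro x y
    rw [one_div_mul_eq_div, div_le_iff₀' (by linarith)]
    exact hlower x y
  refine ⟨fun x y => ⟨hbound x y, hupper x y⟩, hdense, 2 * D, D, by linarith, by linarith,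
    fun x y => ⟨?_, ?_⟩, fun z => ?_⟩
  · rw [← one_div]
    linarith [hbound x y]
  · have h1 := hupper x y
    have h2 : 0 ≤ P.combDist x y := Nat.cast_nonneg _
    nlinarith
  · obtain ⟨x, hx⟩ := hdense z
    exact ⟨x, by linarith⟩
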